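/- Let $H$ be a complex Hilbert space and let $f,g$ be positive linear functionals on $B(H)$ (that is, $f(a^*a)\ge 0$ and $g(a^*a)\ge 0$ for all $a\in B(H)$) that are normal with representing operators $T$ and $S$: $T,S$ are trace class operators on $H$, $f(A)=\operatorname{tr}(AT)$ and $g(A)=\operatorname{tr}(AS)$ for all $A\in B(H)$ (so $T,S\ge 0$). For functionals, $h\le k$ means that $k-h$ is positive. A positive functional $h$ is called $f$-closable if, for every sequence $(a_n)$ in $B(H)$, $f(a_n^*a_n)\to0$ and $h((a_n-a_m)^*(a_n-a_m))\to0$ as $n,m\to\infty$ imply $h(a_n^*a_n)\to0$; it is called $f$-singular if the only positive functional $k$ with $k\le f$ and $k\le h$ is $k=0$. A Lebesgue decomposition of $g$ relative to $f$ is a pair $(g_0,g_1)$ of positive functionals with $g=g_0+g_1$, $g_0$ $f$-closable and $g_1$ $f$-singular. The $f$-regular part $g_r$ of $g$ is the positive functional for which $(g_r,g-g_r)$ is a Lebesgue decomposition of $g$ relative to $f$ and $h\le g_r$ for every $f$-closable positive functional $h\le g$. A positive operator $R$ is called absolutely continuous with respect to $T$ if there are positive operators $R_1\le R_2\le\cdots$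 with $R_n\le c_nT$ for some $c_n\ge0$ and $R_n\to R$ in the strong operator topology; two positive operators are mutually singular if the only positive operator below both is $0$. Ando's $T$-absolutely continuous part $[T]S$ of $S$ is the positive operator such that $[T]S\le S$, $[T]S$ is absolutely continuous with respect to $T$, $S-[T]S$ and $T$ are mutually singular, and $R\le[T]S$ for every positive operator $R\le S$ that is absolutely continuous with respect to $T$. Then $g_r$ and $[T]S$ exist, and the following are equivalent: (i) $g$ has exactly one Lebesgue decomposition relative to $f$; (ii) $g_r\le c f$ for some $c>0$; (iii) $[T]S\le cT$ for some $c>0$. -/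

import Mathlib

open Filter Topology
open scoped ComplexOrder InnerProductSpace

namespace LebesgueDecomposition

section Functionals

variable {A : Type*} [Ring A] [StarRing A] [Algebra ℂ A]

/-- A linear functional `f` on a complex `*`-algebra is positive if `f (a* a) ≥ 0` for all `a`.
(The inequality is the order of `ℂ`: the value is real and nonnegative.) -/
def IsPositiveFunctional (f : A →ₗ[ℂ] ℂ) : Prop :=
  ∀ a : A, 0 ≤ f (star a * a)

/-- The order between functionals: `g ≤ f` if `f - g` is a positive functional. -/
def FunctionalLE (g f : A →ₗ[ℂ] ℂ) : Prop :=
  IsPositiveFunctional (f - g)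

/-- `g` is `f`-closable: `f (aₙ* aₙ) → 0` and `g ((aₙ - aₘ)* (aₙ - aₘ)) → 0` as `n, m → ∞`
imply `g (aₙ* aₙ) → 0`, for every sequence `(aₙ)`. -/
def IsClosableWrt (f g : A →ₗ[ℂ] ℂ) : Prop :=
  ∀ a : ℕ → A,
    Tendsto (fun n => f (star (a n) * a n)) atTop (𝓝 0) →
    Tendsto (fun p : ℕ × ℕ => g (star (a p.1 - a p.2) * (a p.1 - a p.2))) atTop (𝓝 0) →
    Tendsto (fun n => g (star (a n) * a n)) atTop (𝓝 0)

/-- `f` and `g` are mutually singular: the only positive functional below both is `0`. -/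
def MutuallySingularFunctionals (f g : A →ₗ[ℂ] ℂ) : Prop :=
  ∀ h : A →ₗ[ℂ] ℂ, IsPositiveFunctional h → FunctionalLE h f → FunctionalLE h g → h = 0

/-- `(g₀, g₁)` is a Lebesgue decomposition of `g` relative to `f`. -/
structure IsLebesgueDecomposition (f g g₀ g₁ : A →ₗ[ℂ] ℂ) : Prop where
  pos_closable : IsPositiveFunctional g₀
  pos_singular : IsPositiveFunctional g₁
  add_eq : g = g₀ + g₁
  closable : IsClosableWrt f g₀
  singular : MutuallySingularFunctionals f g₁

/-- There is exactly one pair that is a Lebesgue decomposition of `g` relative to `f`. -/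
def HasUniqueLebesgueDecomposition (f g : A →ₗ[ℂ] ℂ) : Prop :=
  ∃! p : (A →ₗ[ℂ] ℂ) × (A →ₗ[ℂ] ℂ), IsLebesgueDecomposition f g p.1 p.2

/-- `r` is the `f`-regular part of `g`: `(r, g - r)` is a Lebesgue decomposition of `g` relative
to `f`, and `h ≤ r` for every `f`-closable positive functional `h ≤ g`. -/
structure IsRegularPart (f g r : A →ₗ[ℂ] ℂ) : Prop where
  decomposition : IsLebesgueDecomposition f g r (g - r)
  extremal : ∀ h : A →ₗ[ℂ] ℂ, IsPositiveFunctional h → IsClosableWrt f h →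
    FunctionalLE h g → FunctionalLE h r

open Classical in
/-- The `f`-regular part of `g` (and `0` if there is none). -/
noncomputable def regularPart (f g : A →ₗ[ℂ] ℂ) : A →ₗ[ℂ] ℂ :=
  if h : ∃ r, IsRegularPart f g r then h.choose else 0

end Functionals

section Operators

variable {H : Type*} [NormedAddCommGroup H] [InnerProductSpace ℂ H]

/-- Absolute continuity `S ≪ T` of positive operators: `S` is the limit, in the strong operator
topology, of an increasing sequence of positive `T`-dominated operators. The order of operators
is the Loewner order. -/
def OperatorAbsolutelyContinuous (S T : H →L[ℂ] H) : Prop :=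
  ∃ R : ℕ → H →L[ℂ] H, Monotone R ∧ (∀ n, 0 ≤ R n) ∧
    (∀ n, ∃ c : ℝ, 0 ≤ c ∧ R n ≤ (c : ℂ) • T) ∧
    ∀ x : H, Tendsto (fun n => R n x) atTop (𝓝 (S x))

/-- Mutual singularity `S ⊥ T` of positive operators. -/
def MutuallySingularOperators (S T : H →L[ℂ] H) : Prop :=
  ∀ R : H →L[ℂ] H, 0 ≤ R → R ≤ S → R ≤ T → R = 0

/-- `W` is Ando's `T`-absolutely continuous part `[T]S` of `S`: `W` is positive and absolutely
continuous with respect to `T`, `S - W` is positive and singular to `T`, and `R ≤ W` for every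
positive `R ≤ S` that is absolutely continuous with respect to `T`. -/
structure IsAbsolutelyContinuousPart (T S W : H →L[ℂ] H) : Prop where
  nonneg : 0 ≤ W
  le : W ≤ S
  absolutelyContinuous : OperatorAbsolutelyContinuous W T
  singular : MutuallySingularOperators (S - W) T
  extremal : ∀ R : H →L[ℂ] H, 0 ≤ R → OperatorAbsolutelyContinuous R T → R ≤ S → R ≤ W

open Classical in
/-- Ando's `T`-absolutely continuous part `[T]S` of `S` (and `0` if there is none). -/
noncomputable def absolutelyContinuousPart (T S : H →L[ℂ] H) : H →L[ℂ] H :=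
  if h : ∃ W, IsAbsolutelyContinuousPart T S W then h.choose else 0

variable [CompleteSpace H]

variable (H) in
/-- The underlying set of a fixed orthonormal basis of `H`. -/
noncomputable def basisSet : Set H := (exists_hilbertBasis ℂ H).choose

variable (H) in
/-- A fixed orthonormal basis of `H`. -/
noncomputable def orthonormalBasis : HilbertBasis (basisSet H) ℂ H :=
  (exists_hilbertBasis ℂ H).choose_spec.choose

/-- The trace `∑ ⟨A e, e⟩`, summed over an orthonormal basis. (For trace class operators it does
not depend on the basis.) -/
noncomputable def trace (A : H →L[ℂ] H) : ℂ :=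
  ∑' e : basisSet H, ⟪orthonormalBasis H e, A (orthonormalBasis H e)⟫_ℂ

/-- `T` is of trace class: the absolute value `|T| = (T* T)^(1/2)` has finite trace. (For positive
operators the finiteness does not depend on the basis.) -/
def IsTraceClass (T : H →L[ℂ] H) : Prop :=
  Summable fun e : basisSet H =>
    ⟪orthonormalBasis H e, CFC.abs T (orthonormalBasis H e)⟫_ℂ

/-- `f` is the normal functional `f_T : A ↦ tr (A T)`, and the trace class operator `T` is its
representing operator. -/
structure IsNormalFunctionalOf (f : (H →L[ℂ] H) →ₗ[ℂ] ℂ) (T : H →L[ℂ] H) : Prop where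
  traceClass : IsTraceClass T
  apply_eq : ∀ A : H →L[ℂ] H, f A = trace (A * T)

end Operators

end LebesgueDecomposition

/-!
The positive functionals below a normal positive functional `g` with representing operator `S`
correspond, in an order-preserving way, to the operators `R` with `0 ≤ R ≤ S`: the operator `R`
(the density, `HasDensity`) is read off from `h (|x⟩⟨y|) = ⟪y, R x⟫`. Rank one operators determine
`h`, because Cauchy-Schwarz bounds `h ((1 - P) A)` by `h (1 - P)` and the latter tends to `0` along
finite rank projections `P` (`HasDensity.hasSum_apply`). Under this correspondence singular
operators give singular functionals, an operator absolutely continuous with respect to `T` gives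
an `f`-closable functional (`OperatorAbsolutelyContinuous.isClosableWrt`), and an `f`-closable
functional gives an operator whose quadratic form is closable with respect to that of `T`
(`IsClosableWrt.isFormClosableWrt`). It remains to decompose `S` with respect to `T`
(`exists_absolutelyContinuousPart`).

Factor `T + S = J* J` with `J` of dense range; then `S = J* B J` and `T = J* (1 - B) J` for an
operator `0 ≤ B ≤ 1`, so the pair `T, S` is replaced by the commuting pair `1 - B, B`. Let `P` be
the projection onto the fixed vectors of `B`. The absolutely continuous part is
`W = J* (B - P) J`: it is the increasing strong limit of `J* (B - Bⁿ⁺¹) J ≤ n T`, the remainder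
`J* P J` is singular to `T`, and a form below `S` that is closable with respect to `T` vanishes on
the range of `P`, hence lies below `W`. So `W` is both `[T]S` and the density of `g_r`.

If `g_r ≤ c f` and `(g₀, g₁)` is a decomposition, then `g_r - g₀` is, up to a scalar, below both `f`
and `g₁`, so it vanishes and the decomposition is unique. If `W` is not dominated by `T`, the
uniform boundedness principle (`exists_le_smul_of_forall_rankOne_le`) provides `u` in the range of
`√(B - P)` for which `|u⟩⟨u|` is not dominated by `1 - B`. A small multiple of `J* |u⟩⟨u| J` can be
moved from `W` to the singular part: the new singular part is still singular to `T`, while the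
reduced `W` stays comparable to `W` and therefore closable. This is a second decomposition.
-/

namespace LebesgueDecomposition

/-! ### Quadratic forms and the Loewner order -/

section Loewner

variable {E : Type*} [NormedAddCommGroup E] [InnerProductSpace ℂ E]

lemma operator_le_iff {A B : E →L[ℂ] E} : A ≤ B ↔ ∀ x, ⟪x, A x⟫_ℂ ≤ ⟪x, B x⟫_ℂ := by
  rw [ContinuousLinearMap.le_def]
  constructor
  · intro h x
    have := h.inner_nonneg_right x
    simpa [inner_sub_right] using this
  · intro h
    rw [ContinuousLinearMap.isPositive_iff_complex]
    intro x
    have h1 : 0 ≤ ⟪x, (B - A) x⟫_ℂ := by simpa [inner_sub_right] using h x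
    rw [← inner_conj_symm, Complex.conj_eq_iff_im.mpr (Complex.nonneg_iff.mp h1).2.symm]
    obtain ⟨h2, h3⟩ := Complex.nonneg_iff.mp h1
    exact ⟨Complex.ext rfl h3, h2⟩

lemma operator_nonneg_iff {A : E →L[ℂ] E} : 0 ≤ A ↔ ∀ x, 0 ≤ ⟪x, A x⟫_ℂ := by
  simp [operator_le_iff]

lemma operator_smul_le_smul {A B : E →L[ℂ] E} (h : A ≤ B) {c : ℝ} (hc : 0 ≤ c) :
    (c : ℂ) • A ≤ (c : ℂ) • B := by
  rw [operator_le_iff] at h ⊢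
  intro x
  rw [smul_apply, smul_apply, inner_smul_right, inner_smul_right]
  exact mul_le_mul_of_nonneg_left (h x) (by exact_mod_cast hc)

lemma operator_smul_nonneg {A : E →L[ℂ] E} (h : 0 ≤ A) {c : ℝ} (hc : 0 ≤ c) :
    0 ≤ (c : ℂ) • A := by
  simpa using operator_smul_le_smul h hc

/-- A vector killed by a positive operator can be subtracted without changing the quadratic
form. -/
lemma inner_sub_apply_of_apply_eq_zero {D : E →L[ℂ] E} (hD : 0 ≤ D) {z : E} (hz : D z = 0)
    (x : E) : ⟪x - z, D (x - z)⟫_ℂ = ⟪x, D x⟫_ℂ := by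
  have hs := (ContinuousLinearMap.nonneg_iff_isPositive _).mp hD
  rw [map_sub, hz, sub_zero, inner_sub_left, ← hs.inner_left_eq_inner_right z x, hz,
    inner_zero_left, sub_zero]

lemma inner_rankOne_self (u x : E) :
    ⟪x, InnerProductSpace.rankOne ℂ u u x⟫_ℂ = ((‖⟪u, x⟫_ℂ‖ ^ 2 : ℝ) : ℂ) := by
  rw [InnerProductSpace.rankOne_apply, inner_smul_right, ← inner_conj_symm x u, Complex.mul_conj,
    Complex.normSq_eq_norm_sq]

lemma rankOne_self_nonneg (u : E) : 0 ≤ InnerProductSpace.rankOne ℂ u u :=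
  (ContinuousLinearMap.nonneg_iff_isPositive _).mpr (InnerProductSpace.isPositive_rankOne_self u)

variable [CompleteSpace E]

lemma inner_eq_norm_sqrt_sq {D : E →L[ℂ] E} (hD : 0 ≤ D) (x : E) :
    ⟪x, D x⟫_ℂ = (‖CFC.sqrt D x‖ : ℂ) ^ 2 := by
  have h : D x = CFC.sqrt D (CFC.sqrt D x) := by
    conv_lhs => rw [← CFC.sqrt_mul_sqrt_self D hD]
    rfl
  have hs := ((ContinuousLinearMap.nonneg_iff_isPositive _).mp (CFC.sqrt_nonneg D))
  rw [h, ← hs.inner_left_eq_inner_right, inner_self_eq_norm_sq_to_K]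
  rfl

lemma apply_eq_zero_of_inner_eq_zero {D : E →L[ℂ] E} (hD : 0 ≤ D) {x : E}
    (h : ⟪x, D x⟫_ℂ = 0) : D x = 0 := by
  rw [inner_eq_norm_sqrt_sq hD] at h
  have h1 : CFC.sqrt D x = 0 := by simpa using h
  conv_lhs => rw [← CFC.sqrt_mul_sqrt_self D hD]
  simp [h1]

lemma inner_sqrt_left (D : E →L[ℂ] E) (x y : E) :
    ⟪CFC.sqrt D x, y⟫_ℂ = ⟪x, CFC.sqrt D y⟫_ℂ :=
  ((ContinuousLinearMap.nonneg_iff_isPositive _).mp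
    (CFC.sqrt_nonneg D)).inner_left_eq_inner_right x y

lemma le_smul_iff_norm_sqrt {A B : E →L[ℂ] E} (hA : 0 ≤ A) (hB : 0 ≤ B) {c : ℝ} :
    A ≤ (c : ℂ) • B ↔ ∀ x, ‖CFC.sqrt A x‖ ^ 2 ≤ c * ‖CFC.sqrt B x‖ ^ 2 := by
  rw [operator_le_iff]
  refine forall_congr' fun x => ?_
  rw [smul_apply, inner_smul_right, inner_eq_norm_sqrt_sq hA,
    inner_eq_norm_sqrt_sq hB]
  exact_mod_cast Iff.rfl

lemma rankOne_self_le_smul_iff {N : E →L[ℂ] E} (hN : 0 ≤ N) {u : E} {c : ℝ} :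
    InnerProductSpace.rankOne ℂ u u ≤ (c : ℂ) • N ↔
      ∀ x, ‖⟪u, x⟫_ℂ‖ ^ 2 ≤ c * ‖CFC.sqrt N x‖ ^ 2 := by
  rw [operator_le_iff]
  refine forall_congr' fun x => ?_
  rw [smul_apply, inner_smul_right, inner_rankOne_self,
    inner_eq_norm_sqrt_sq hN]
  exact_mod_cast Iff.rfl

lemma rankOne_sqrt_le {G : E →L[ℂ] E} (hG : 0 ≤ G) (v : E) :
    InnerProductSpace.rankOne ℂ (CFC.sqrt G v) (CFC.sqrt G v) ≤ ((‖v‖ ^ 2 : ℝ) : ℂ) • G := by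
  rw [rankOne_self_le_smul_iff hG]
  intro x
  rw [inner_sqrt_left, ← mul_pow]
  gcongr
  exact norm_inner_le_norm _ _

/-- If each rank one operator `|u⟩⟨u|` with `u` in the range of `√G` is dominated by a multiple of
`N`, then so is `G`: by the uniform boundedness principle the multiples can be chosen uniformly. -/
lemma exists_le_smul_of_forall_rankOne_le {G N : E →L[ℂ] E} (hG : 0 ≤ G) (hN : 0 ≤ N)
    (h : ∀ v, ∃ c : ℝ, 0 < c ∧
      InnerProductSpace.rankOne ℂ (CFC.sqrt G v) (CFC.sqrt G v) ≤ (c : ℂ) • N) :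
    ∃ c : ℝ, 0 < c ∧ G ≤ (c : ℂ) • N := by
  obtain ⟨C, hC⟩ := banach_steinhaus
    (g := fun x : {x : E // ‖CFC.sqrt N x‖ ≤ 1} => innerSL ℂ (CFC.sqrt G x)) (by
      intro v
      obtain ⟨c, hc, hv⟩ := h v
      rw [rankOne_self_le_smul_iff hN] at hv
      refine ⟨c + 1, fun x => ?_⟩
      rw [innerSL_apply_apply, norm_inner_symm]
      have hx := hv x
      rw [inner_sqrt_left] at hx
      have h1 : ‖CFC.sqrt N x‖ ^ 2 ≤ 1 := pow_le_one₀ (norm_nonneg _) x.2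
      have h2 : ‖⟪v, CFC.sqrt G x⟫_ℂ‖ ^ 2 ≤ c := hx.trans (by nlinarith)
      nlinarith [norm_nonneg ⟪v, CFC.sqrt G x⟫_ℂ])
  have hC0 : 0 ≤ C := (norm_nonneg _).trans (hC ⟨0, by simp⟩)
  refine ⟨C ^ 2 + 1, by positivity, ?_⟩
  rw [le_smul_iff_norm_sqrt hG hN]
  intro x
  have key : ∀ t : ℝ, ‖CFC.sqrt N x‖ < t → ‖CFC.sqrt G x‖ ≤ C * t := by
    intro t ht
    have ht0 : 0 < t := (norm_nonneg _).trans_lt ht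
    have h1 : ‖CFC.sqrt N ((t⁻¹ : ℂ) • x)‖ ≤ 1 := by
      rw [map_smul, norm_smul, norm_inv, Complex.norm_of_nonneg ht0.le, inv_mul_le_one₀ ht0]
      exact ht.le
    have h2 := hC ⟨_, h1⟩
    rw [innerSL_apply_norm, map_smul, norm_smul, norm_inv, Complex.norm_of_nonneg ht0.le,
      inv_mul_le_iff₀ ht0] at h2
    linarith
  have h3 : ‖CFC.sqrt G x‖ ≤ C * ‖CFC.sqrt N x‖ := by
    have : Tendsto (fun t : ℝ => C * t) (𝓝[>] ‖CFC.sqrt N x‖) (𝓝 (C * ‖CFC.sqrt N x‖)) :=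
      ((continuous_const.mul continuous_id).tendsto _).mono_left nhdsWithin_le_nhds
    exact ge_of_tendsto this (eventually_mem_nhdsWithin.mono fun t ht => key t ht)
  calc ‖CFC.sqrt G x‖ ^ 2 ≤ (C * ‖CFC.sqrt N x‖) ^ 2 := by gcongr
    _ ≤ (C ^ 2 + 1) * ‖CFC.sqrt N x‖ ^ 2 := by nlinarith [sq_nonneg ‖CFC.sqrt N x‖]

/-- A multiple of `|u⟩⟨u|` is singular to `N` when `|u⟩⟨u|` is not dominated by `N`: every positive
operator below a multiple of `|u⟩⟨u|` is itself a multiple of `|u⟩⟨u|`. -/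
lemma mutuallySingularOperators_smul_rankOne {N : E →L[ℂ] E} (hN : 0 ≤ N) {u : E}
    (hu : ¬ ∃ c : ℝ, 0 < c ∧ InnerProductSpace.rankOne ℂ u u ≤ (c : ℂ) • N) (α : ℂ) :
    MutuallySingularOperators (α • InnerProductSpace.rankOne ℂ u u) N := by
  intro D hD hDu hDN
  have hu0 : u ≠ 0 := by
    rintro rfl
    exact hu ⟨1, one_pos, by simpa using hN⟩
  have huu : ⟪u, u⟫_ℂ ≠ 0 := inner_self_ne_zero.mpr hu0
  have hperp : ∀ y, ⟪u, y⟫_ℂ = 0 → D y = 0 := by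
    intro y hy
    refine apply_eq_zero_of_inner_eq_zero hD (le_antisymm ?_ (operator_nonneg_iff.mp hD y))
    simpa [hy] using operator_le_iff.mp hDu y
  have hx : ∀ x, D x = (⟪u, x⟫_ℂ / ⟪u, u⟫_ℂ) • D u := by
    intro x
    have h1 := hperp (x - (⟪u, x⟫_ℂ / ⟪u, u⟫_ℂ) • u)
      (by rw [inner_sub_right, inner_smul_right, div_mul_cancel₀ _ huu, sub_self])
    rwa [map_sub, map_smul, sub_eq_zero] at h1
  by_cases hDu0 : D u = 0
  · ext x
    simp [hx x, hDu0]
  · exfalso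
    apply hu
    set s := CFC.sqrt D
    have hs : ∀ x, ‖s x‖ ^ 2 = (‖⟪u, x⟫_ℂ‖ / ‖⟪u, u⟫_ℂ‖) ^ 2 * ‖s u‖ ^ 2 := by
      intro x
      set t := ⟪u, x⟫_ℂ / ⟪u, u⟫_ℂ with ht
      have h1 : D (x - t • u) = 0 := by rw [map_sub, map_smul, hx x, sub_self]
      have h2 := inner_sub_apply_of_apply_eq_zero hD h1 x
      rw [sub_sub_cancel, inner_eq_norm_sqrt_sq hD, inner_eq_norm_sqrt_sq hD, map_smul,
        norm_smul] at h2
      norm_cast at h2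
      rw [← h2, mul_pow, ht, norm_div]
    have hsu : 0 < ‖s u‖ := by
      rw [norm_pos_iff]
      intro h
      apply hDu0
      apply apply_eq_zero_of_inner_eq_zero hD
      rw [inner_eq_norm_sqrt_sq hD]
      simp [s, h]
    have huu' : 0 < ‖⟪u, u⟫_ℂ‖ := norm_pos_iff.mpr huu
    refine ⟨‖⟪u, u⟫_ℂ‖ ^ 2 / ‖s u‖ ^ 2, by positivity, ?_⟩
    rw [rankOne_self_le_smul_iff hN]
    intro x
    have h1 : ‖s x‖ ^ 2 ≤ ‖CFC.sqrt N x‖ ^ 2 := by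
      have h := operator_le_iff.mp hDN x
      rw [inner_eq_norm_sqrt_sq hD, inner_eq_norm_sqrt_sq hN] at h
      exact_mod_cast h
    calc ‖⟪u, x⟫_ℂ‖ ^ 2 = ‖⟪u, u⟫_ℂ‖ ^ 2 / ‖s u‖ ^ 2 * ‖s x‖ ^ 2 := by
          rw [hs x]; field_simp
      _ ≤ _ := by gcongr

end Loewner

/-! ### The decomposition of a pair `B`, `1 - B` of commuting operators -/

section Commuting

variable {E : Type*} [NormedAddCommGroup E] [InnerProductSpace ℂ E] [CompleteSpace E]

lemma cauchySeq_pow_apply {B : E →L[ℂ] E} (hB0 : 0 ≤ B) (hB1 : B ≤ 1) (x : E) :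
    CauchySeq fun n : ℕ => (B ^ n) x := by
  -- `‖Bⁿ x - Bᵐ x‖²` is a combination of terms of the convergent sequence `⟪x, Bⁿ x⟫`
  obtain ⟨a, ha⟩ : ∃ a : ℕ → ℝ, ∀ n, a n = (⟪x, (B ^ n) x⟫_ℂ).re := ⟨_, fun _ => rfl⟩
  have ha_anti : Antitone a := fun m n hmn => by
    rw [ha, ha]
    exact (Complex.le_def.mp
      (operator_le_iff.mp (CStarAlgebra.pow_antitone hB0 hB1 hmn) x)).1
  have ha0 : ∀ n, 0 ≤ a n := fun n => by
    rw [ha]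
    exact (Complex.le_def.mp (operator_nonneg_iff.mp (CStarAlgebra.pow_nonneg hB0 n) x)).1
  obtain ⟨l, hl⟩ : ∃ l, Tendsto a atTop (𝓝 l) :=
    ⟨_, tendsto_atTop_ciInf ha_anti ⟨0, by rintro _ ⟨n, rfl⟩; exact ha0 n⟩⟩
  have hinner : ∀ m n, (⟪(B ^ m) x, (B ^ n) x⟫_ℂ).re = a (m + n) := by
    intro m n
    rw [((ContinuousLinearMap.nonneg_iff_isPositive _).mp
      (CStarAlgebra.pow_nonneg hB0 m)).inner_left_eq_inner_right, ha, pow_add]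
    rfl
  have hnorm : ∀ m, ‖(B ^ m) x‖ ^ 2 = a (m + m) := by
    intro m
    rw [← hinner m m, inner_self_eq_norm_sq_to_K]
    norm_cast
  have hdist : ∀ m n, ‖(B ^ m) x - (B ^ n) x‖ ^ 2 = a (m + m) - 2 * a (m + n) + a (n + n) := by
    intro m n
    rw [@norm_sub_sq ℂ, hnorm, hnorm, ← hinner m n]
    rfl
  rw [cauchySeq_iff_tendsto_dist_atTop_0]
  have hfst : Tendsto (fun p : ℕ × ℕ => p.1) atTop atTop := by
    rw [← prod_atTop_atTop_eq]; exact tendsto_fst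
  have hsnd : Tendsto (fun p : ℕ × ℕ => p.2) atTop atTop := by
    rw [← prod_atTop_atTop_eq]; exact tendsto_snd
  have h1 := hl.comp (hfst.atTop_add_atTop hfst)
  have h2 := hl.comp (hfst.atTop_add_atTop hsnd)
  have h3 := hl.comp (hsnd.atTop_add_atTop hsnd)
  have h4 := (h1.sub (h2.const_mul 2)).add h3
  have h5 : Tendsto (fun p : ℕ × ℕ => ‖(B ^ p.1) x - (B ^ p.2) x‖ ^ 2) atTop (𝓝 0) := by
    rw [show (0 : ℝ) = l - 2 * l + l by ring]
    exact h4.congr fun p => (hdist p.1 p.2).symm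
  have h6 := h5.sqrt
  rw [Real.sqrt_zero] at h6
  refine h6.congr fun p => ?_
  rw [Real.sqrt_sq (norm_nonneg _), dist_eq_norm]

/-- For `0 ≤ B ≤ 1` the powers `Bⁿ` converge strongly to the projection onto the fixed vectors
of `B`. -/
lemma exists_fixedProjection {B : E →L[ℂ] E} (hB0 : 0 ≤ B) (hB1 : B ≤ 1) :
    ∃ P : E →L[ℂ] E, IsStarProjection P ∧ B * P = P ∧
      ∀ x, Tendsto (fun n : ℕ => (B ^ n) x) atTop (𝓝 (P x)) := by
  let U : Submodule ℂ E := LinearMap.ker ((1 - B : E →L[ℂ] E) : E →ₗ[ℂ] E)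
  have hmem : ∀ x, x ∈ U ↔ B x = x := by
    intro x
    rw [LinearMap.mem_ker, ContinuousLinearMap.coe_coe, sub_apply, sub_eq_zero, eq_comm]
    rfl
  have hUc : IsClosed (U : Set E) := (1 - B : E →L[ℂ] E).isClosed_ker
  have : CompleteSpace U := hUc.completeSpace_coe
  have hBs := fun n : ℕ => (ContinuousLinearMap.nonneg_iff_isPositive _).mp
    (CStarAlgebra.pow_nonneg hB0 n)
  refine ⟨U.starProjection, isStarProjection_starProjection, ?_, fun x => ?_⟩
  · ext x
    exact (hmem _).mp (U.starProjection_apply_mem x)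
  obtain ⟨z, hz⟩ := cauchySeq_tendsto_of_complete (cauchySeq_pow_apply hB0 hB1 x)
  have hzU : z ∈ U := by
    rw [hmem]
    refine tendsto_nhds_unique ((B.continuous.tendsto z).comp hz) ?_
    refine (hz.comp (tendsto_add_atTop_nat 1)).congr fun n => ?_
    exact congr($(pow_succ' B n) x)
  have hxz : x - z ∈ Uᗮ := by
    rw [Submodule.mem_orthogonal]
    intro w hw
    have hw' : ∀ n : ℕ, (B ^ n) w = w := by
      intro n
      induction n with
      | zero => simp
      | succ n ih => rw [pow_succ, mul_apply_eq_comp, (hmem w).mp hw, ih]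
    have h1 : Tendsto (fun n : ℕ => ⟪w, (B ^ n) x⟫_ℂ) atTop (𝓝 ⟪w, z⟫_ℂ) :=
      tendsto_const_nhds.inner hz
    have h2 : ∀ n : ℕ, ⟪w, (B ^ n) x⟫_ℂ = ⟪w, x⟫_ℂ := by
      intro n
      rw [← (hBs n).inner_left_eq_inner_right, hw' n]
    simp only [h2] at h1
    rw [inner_sub_right, tendsto_nhds_unique tendsto_const_nhds h1, sub_self]
  rwa [Submodule.eq_starProjection_of_mem_orthogonal hzU hxz]

variable {B P : E →L[ℂ] E}

/-- Adding to the projection onto the fixed vectors of `B` an operator that vanishes there does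
not affect singularity to `1 - B`. -/
lemma MutuallySingularOperators.fixedProjection_add {A : E →L[ℂ] E}
    (hP : IsStarProjection P) (hBP : B * P = P) (hA : 0 ≤ A) (hAP : A * P = 0)
    (h : MutuallySingularOperators A (1 - B)) : MutuallySingularOperators (P + A) (1 - B) := by
  intro D hD hDA hDB
  refine h D hD ?_ hDB
  have hDP : ∀ x, D (P x) = 0 := by
    intro x
    refine apply_eq_zero_of_inner_eq_zero hD (le_antisymm ?_ (operator_nonneg_iff.mp hD _))
    have h1 : B (P x) = P x := congr($hBP x)
    simpa [h1] using operator_le_iff.mp hDB (P x)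
  rw [operator_le_iff]
  intro x
  have h1 := operator_le_iff.mp hDA (x - P x)
  have h2 : P (P x) = P x := congr($(hP.isIdempotentElem.eq) x)
  have hAP' : A (P x) = 0 := congr($hAP x)
  rwa [inner_sub_apply_of_apply_eq_zero hD (hDP x), add_apply, inner_add_right, map_sub P, h2,
    sub_self, inner_zero_right, zero_add, inner_sub_apply_of_apply_eq_zero hA hAP'] at h1

lemma fixedProjection_mul (hB0 : 0 ≤ B) (hP : IsStarProjection P) (hBP : B * P = P) :
    P * B = P := by
  simpa [hP.isSelfAdjoint.star_eq, (IsSelfAdjoint.of_nonneg hB0).star_eq] using congr(star $hBP)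

lemma one_sub_mul_mul_one_sub (hB0 : 0 ≤ B) (hP : IsStarProjection P) (hBP : B * P = P) :
    star (1 - P) * B * (1 - P) = B - P := by
  rw [star_sub, star_one, hP.isSelfAdjoint.star_eq, sub_mul, one_mul,
    fixedProjection_mul hB0 hP hBP, mul_one_sub, sub_mul, hBP,
    hP.isIdempotentElem.eq, sub_self, sub_zero]

lemma sub_fixedProjection_nonneg (hB0 : 0 ≤ B) (hP : IsStarProjection P) (hBP : B * P = P) :
    0 ≤ B - P := by
  rw [← one_sub_mul_mul_one_sub hB0 hP hBP]
  exact star_left_conjugate_nonneg hB0 _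

lemma sub_pow_succ_le (hB0 : 0 ≤ B) (hB1 : B ≤ 1) (n : ℕ) :
    B - B ^ (n + 1) ≤ ((n : ℝ) : ℂ) • (1 - B) := by
  have hstep : ∀ k : ℕ, B ^ (k + 1) - B ^ (k + 2) ≤ 1 - B := by
    intro k
    have h1 : 0 ≤ (1 - B) * (1 - B ^ (k + 1)) := by
      refine Commute.mul_nonneg (sub_nonneg.mpr hB1) (sub_nonneg.mpr ?_) ?_
      · simpa using CStarAlgebra.pow_antitone hB0 hB1 (Nat.zero_le (k + 1))
      · exact ((Commute.one_left _).sub_left ((Commute.one_right _).sub_right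
          (Commute.self_pow B _)))
    rw [← sub_nonneg]
    rw [pow_succ' B (k + 1)]
    convert h1 using 1
    generalize B ^ (k + 1) = C
    noncomm_ring
  induction n with
  | zero => simp
  | succ n ih =>
    calc B - B ^ (n + 1 + 1) = (B - B ^ (n + 1)) + (B ^ (n + 1) - B ^ (n + 2)) := by abel
      _ ≤ ((n : ℝ) : ℂ) • (1 - B) + (1 - B) := add_le_add ih (hstep n)
      _ = _ := by push_cast; rw [add_smul, one_smul]

/-- If `B - P` is not dominated by `1 - B`, then a rank one piece `A` of `B - P` can be added to
`P` without losing singularity to `1 - B`. -/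
lemma exists_singular_perturbation (hB0 : 0 ≤ B) (hB1 : B ≤ 1) (hP : IsStarProjection P)
    (hBP : B * P = P) (h : ¬ ∃ c : ℝ, 0 < c ∧ B - P ≤ (c : ℂ) • (1 - B)) :
    ∃ A : E →L[ℂ] E, 0 ≤ A ∧ A ≠ 0 ∧ A ≤ ((2⁻¹ : ℝ) : ℂ) • (B - P) ∧
      MutuallySingularOperators (P + A) (1 - B) := by
  have hN : 0 ≤ 1 - B := sub_nonneg.mpr hB1
  have hG := sub_fixedProjection_nonneg hB0 hP hBP
  obtain ⟨v, hv⟩ : ∃ v, ¬ ∃ c : ℝ, 0 < c ∧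
      InnerProductSpace.rankOne ℂ (CFC.sqrt (B - P) v) (CFC.sqrt (B - P) v) ≤
        (c : ℂ) • (1 - B) := by
    by_contra! h'
    exact h (exists_le_smul_of_forall_rankOne_le hG hN h')
  have huG := rankOne_sqrt_le hG v
  have hsP : ∀ x, CFC.sqrt (B - P) (P x) = 0 := by
    intro x
    have h1 := inner_eq_norm_sqrt_sq hG (P x)
    have h2 : (B - P) (P x) = 0 := by
      rw [sub_apply, sub_eq_zero]
      exact congr($(hBP.trans hP.isIdempotentElem.eq.symm) x)
    rw [h2, inner_zero_right] at h1
    simpa using h1.symm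
  have huP : ∀ x, ⟪CFC.sqrt (B - P) v, P x⟫_ℂ = 0 := by
    intro x
    rw [inner_sqrt_left, hsP, inner_zero_right]
  have hu0 : CFC.sqrt (B - P) v ≠ 0 := by
    intro h0
    exact hv ⟨1, one_pos, by simpa [h0] using hN⟩
  have hv0 : 0 < ‖v‖ := by
    rw [norm_pos_iff]
    rintro rfl
    exact hu0 (map_zero _)
  generalize CFC.sqrt (B - P) v = u at hv huG huP hu0
  -- half of a multiple of `|u⟩⟨u|` that is below `B - P`
  obtain ⟨α, hα0, hα⟩ : ∃ α : ℝ, 0 < α ∧ α * ‖v‖ ^ 2 = 2⁻¹ :=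
    ⟨2⁻¹ / ‖v‖ ^ 2, by positivity, by field_simp⟩
  have hA := operator_smul_nonneg (rankOne_self_nonneg u) hα0.le
  refine ⟨(α : ℂ) • InnerProductSpace.rankOne ℂ u u, hA, ?_, ?_, ?_⟩
  · exact smul_ne_zero (Complex.ofReal_ne_zero.mpr hα0.ne')
      (InnerProductSpace.rankOne_ne_zero hu0 hu0)
  · refine (operator_smul_le_smul huG hα0.le).trans_eq ?_
    rw [smul_smul, ← Complex.ofReal_mul, hα]
  · refine (mutuallySingularOperators_smul_rankOne hN hv _).fixedProjection_add hP hBP hA ?_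
    ext x
    rw [mul_apply_eq_comp, smul_apply, InnerProductSpace.rankOne_apply, huP, zero_smul, smul_zero]
    rfl

end Commuting

/-! ### Pulling operators back along a map with dense range -/

section Pullback

variable {H : Type*} [NormedAddCommGroup H] [InnerProductSpace ℂ H] [CompleteSpace H]
  {K : Type*} [NormedAddCommGroup K] [InnerProductSpace ℂ K] [CompleteSpace K]

/-- The pullback `J* D J` of an operator `D` on `K` along `J : H → K`: the operator on `H` whose
sesquilinear form is `⟪J x, D (J y)⟫`. -/
noncomputable def pullback (J : H →L[ℂ] K) (D : K →L[ℂ] K) : H →L[ℂ] H :=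
  ContinuousLinearMap.adjoint J ∘L D ∘L J

variable {J : H →L[ℂ] K} {A C D : K →L[ℂ] K}

lemma inner_pullback (x y : H) : ⟪x, pullback J D y⟫_ℂ = ⟪J x, D (J y)⟫_ℂ := by
  simp [pullback, ContinuousLinearMap.adjoint_inner_right]

lemma pullback_sub : pullback J (A - D) = pullback J A - pullback J D := by
  simp [pullback, ContinuousLinearMap.sub_comp, ContinuousLinearMap.comp_sub]

lemma pullback_smul (c : ℂ) : pullback J (c • D) = c • pullback J D := by
  simp [pullback, ContinuousLinearMap.smul_comp]

lemma pullback_zero : pullback J (0 : K →L[ℂ] K) = 0 := by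
  simp [pullback]

lemma pullback_mono (h : A ≤ D) : pullback J A ≤ pullback J D := by
  rw [operator_le_iff] at h ⊢
  intro x
  simpa only [inner_pullback] using h (J x)

lemma pullback_nonneg (h : 0 ≤ D) : 0 ≤ pullback J D := by
  simpa [pullback_zero] using pullback_mono (J := J) h

lemma pullback_le_iff (hJ : DenseRange J) : pullback J A ≤ pullback J D ↔ A ≤ D := by
  refine ⟨fun h => ?_, pullback_mono⟩
  rw [operator_le_iff] at h ⊢
  intro y
  refine hJ.induction_on y (isClosed_le (by fun_prop) (by fun_prop)) fun x => ?_
  simpa only [inner_pullback] using h x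

lemma pullback_injective (hJ : DenseRange J) : Function.Injective (pullback J) := fun _ _ h =>
  le_antisymm ((pullback_le_iff hJ).mp h.le) ((pullback_le_iff hJ).mp h.ge)

/-- Every positive operator below `J* J` is pulled back from a positive operator. -/
lemma exists_eq_pullback (hJ : DenseRange J) {R : H →L[ℂ] H} (hR : 0 ≤ R)
    (hRJ : R ≤ pullback J 1) : ∃ D : K →L[ℂ] K, 0 ≤ D ∧ R = pullback J D := by
  have hbound : ∀ x, ‖CFC.sqrt R x‖ ≤ 1 * ‖J x‖ := by
    intro x
    have h1 := operator_le_iff.mp hRJ x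
    rw [inner_pullback, inner_eq_norm_sqrt_sq hR, one_apply_eq_self,
      inner_self_eq_norm_sq_to_K] at h1
    change (‖CFC.sqrt R x‖ : ℂ) ^ 2 ≤ (‖J x‖ : ℂ) ^ 2 at h1
    have h2 : ‖CFC.sqrt R x‖ ^ 2 ≤ ‖J x‖ ^ 2 := by exact_mod_cast h1
    rw [one_mul]
    exact le_of_sq_le_sq h2 (norm_nonneg _)
  let V : K →L[ℂ] H :=
    ((CFC.sqrt R : H →L[ℂ] H) : H →ₗ[ℂ] H).extendOfNorm (J : H →ₗ[ℂ] K)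
  have hV : ∀ x, V (J x) = CFC.sqrt R x := LinearMap.extendOfNorm_eq hJ ⟨1, hbound⟩
  refine ⟨ContinuousLinearMap.adjoint V ∘L V, ?_, ?_⟩
  · exact (ContinuousLinearMap.nonneg_iff_isPositive _).mpr
      (ContinuousLinearMap.isPositive_adjoint_comp_self V)
  · ext y
    refine ext_inner_left ℂ fun x => ?_
    rw [inner_pullback, ContinuousLinearMap.comp_apply, ContinuousLinearMap.adjoint_inner_right,
      hV, hV, inner_sqrt_left]
    conv_lhs => rw [← CFC.sqrt_mul_sqrt_self R hR]
    rfl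

/-- Since `C ≤ 1`, operators below `J* C J` are themselves pulled back, so singularity can be
tested before pulling back. -/
lemma MutuallySingularOperators.pullback (hJ : DenseRange J) (hC : C ≤ 1)
    (h : MutuallySingularOperators A C) :
    MutuallySingularOperators (pullback J A) (pullback J C) := by
  intro R hR hRA hRC
  obtain ⟨D, hD, rfl⟩ := exists_eq_pullback hJ hR (hRC.trans (pullback_mono hC))
  rw [pullback_le_iff hJ] at hRA hRC
  rw [h D hD hRA hRC, pullback_zero]

/-- For `Q ≥ 0`, the map `√Q` into the closure of its range has dense range and satisfies
`J* J = Q`. -/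
lemma exists_denseRange_pullback_one_eq {Q : H →L[ℂ] H} (hQ : 0 ≤ Q) :
    ∃ (U : Submodule ℂ H) (_ : CompleteSpace U) (J : H →L[ℂ] U), DenseRange J ∧
      ∀ x y, ⟪x, Q y⟫_ℂ = ⟪J x, J y⟫_ℂ := by
  let s : H →L[ℂ] H := CFC.sqrt Q
  let U := (LinearMap.range (s : H →ₗ[ℂ] H)).topologicalClosure
  have hmem : ∀ x, s x ∈ U := fun x =>
    Submodule.le_topologicalClosure _ (LinearMap.mem_range_self _ x)
  refine ⟨U, (Submodule.isClosed_topologicalClosure _).completeSpace_coe, s.codRestrict U hmem,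
    ?_, fun x y => ?_⟩
  · rintro ⟨y, hy⟩
    rw [closure_subtype, ← Set.range_comp]
    exact hy
  · rw [Submodule.coe_inner]
    simp only [ContinuousLinearMap.coe_codRestrict_apply]
    rw [inner_sqrt_left]
    conv_lhs => rw [← CFC.sqrt_mul_sqrt_self Q hQ]
    rfl

/-- `R` is closable with respect to `T` as a quadratic form: `⟪xₙ, T xₙ⟫ → 0` and
`⟪xₙ - xₘ, R (xₙ - xₘ)⟫ → 0` imply `⟪xₙ, R xₙ⟫ → 0`. -/
def IsFormClosableWrt (T R : H →L[ℂ] H) : Prop :=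
  ∀ x : ℕ → H, Tendsto (fun n => ⟪x n, T (x n)⟫_ℂ) atTop (𝓝 0) →
    Tendsto (fun p : ℕ × ℕ => ⟪x p.1 - x p.2, R (x p.1 - x p.2)⟫_ℂ) atTop (𝓝 0) →
    Tendsto (fun n => ⟪x n, R (x n)⟫_ℂ) atTop (𝓝 0)

variable {B P : K →L[ℂ] K}

/-- A form closable with respect to `J* (1 - B) J` vanishes on the fixed vectors of `B`, because
these are limits of vectors `J xₙ` with `⟪J xₙ, (1 - B) (J xₙ)⟫ → 0`. -/
lemma IsFormClosableWrt.apply_eq_zero (hJ : DenseRange J) (hD : 0 ≤ D)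
    (h : IsFormClosableWrt (LebesgueDecomposition.pullback J (1 - B))
      (LebesgueDecomposition.pullback J D)) {y : K} (hy : B y = y) : D y = 0 := by
  obtain ⟨z, hz, hzy⟩ := mem_closure_iff_seq_limit.mp (hJ y)
  choose x hx using hz
  have hx' : Tendsto (fun n => J (x n)) atTop (𝓝 y) := by simpa only [hx] using hzy
  have hform : ∀ (A : K →L[ℂ] K) {ι : Type} {l : Filter ι} {w : ι → K} {w₀ : K},
      Tendsto w l (𝓝 w₀) → Tendsto (fun i => ⟪w i, A (w i)⟫_ℂ) l (𝓝 ⟪w₀, A w₀⟫_ℂ) :=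
    fun A _ _ _ _ hw => hw.inner ((A.continuous.tendsto _).comp hw)
  have h1 := h x ?_ ?_
  · simp only [inner_pullback] at h1
    exact apply_eq_zero_of_inner_eq_zero hD (tendsto_nhds_unique (hform D hx') h1)
  · simp only [inner_pullback]
    simpa [hy] using hform (1 - B) hx'
  · simp only [inner_pullback, map_sub J]
    have h2 : Tendsto (fun p : ℕ × ℕ => J (x p.1) - J (x p.2)) atTop (𝓝 0) := by
      rw [← prod_atTop_atTop_eq, ← sub_self y]
      exact (hx'.comp tendsto_fst).sub (hx'.comp tendsto_snd)
    simpa using hform D h2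

end Pullback

/-! ### The absolutely continuous part of a positive operator -/

section AbsolutelyContinuousPart

variable {H : Type*} [NormedAddCommGroup H] [InnerProductSpace ℂ H] [CompleteSpace H]

/-- The absolutely continuous part `W` of `S`, with its maximality stated for form closability.
If `W` is not dominated by `T`, a rank one piece can be moved from `W` to the singular part. -/
theorem exists_absolutelyContinuousPart {T S : H →L[ℂ] H} (hT : 0 ≤ T) (hS : 0 ≤ S) :
    ∃ W : H →L[ℂ] H, 0 ≤ W ∧ W ≤ S ∧ OperatorAbsolutelyContinuous W T ∧
      MutuallySingularOperators (S - W) T ∧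
      (∀ R, 0 ≤ R → R ≤ S → IsFormClosableWrt T R → R ≤ W) ∧
      ((∃ c : ℝ, 0 < c ∧ W ≤ (c : ℂ) • T) ∨
        ∃ S₀ : H →L[ℂ] H, ((2⁻¹ : ℝ) : ℂ) • W ≤ S₀ ∧ S₀ ≤ W ∧ S₀ ≠ W ∧
          MutuallySingularOperators (S - S₀) T) := by
  -- `K` is a Hilbert space with a dense map `J : H → K` such that `J* J = T + S`
  obtain ⟨K, _, J, hJ, hJQ⟩ := exists_denseRange_pullback_one_eq (add_nonneg hT hS)
  have hQ : T + S = pullback J 1 := by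
    ext y
    refine ext_inner_left ℂ fun x => ?_
    rw [inner_pullback, hJQ, one_apply_eq_self]
  obtain ⟨B, hB0, hSB⟩ := exists_eq_pullback hJ hS (by rw [← hQ]; exact le_add_of_nonneg_left hT)
  have hTB : T = pullback J (1 - B) := by
    rw [pullback_sub, ← hQ, ← hSB, add_sub_cancel_right]
  have hN : 0 ≤ 1 - B := by
    rw [← pullback_le_iff hJ, pullback_zero, ← hTB]
    exact hT
  have hB1 : B ≤ 1 := sub_nonneg.mp hN
  have hN1 : 1 - B ≤ 1 := sub_le_self _ hB0
  obtain ⟨P, hP, hBP, hlim⟩ := exists_fixedProjection hB0 hB1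
  have hG := sub_fixedProjection_nonneg hB0 hP hBP
  have hGP : (B - P) * P = 0 := by rw [sub_mul, hBP, hP.isIdempotentElem.eq, sub_self]
  refine ⟨pullback J (B - P), pullback_nonneg hG, ?_, ?_, ?_, ?_, ?_⟩
  · rw [hSB]
    exact pullback_mono (sub_le_self _ hP.nonneg)
  · refine ⟨fun n => pullback J (B - B ^ (n + 1)), ?_, ?_, ?_, ?_⟩
    · exact fun m n hmn => pullback_mono (sub_le_sub_left
        (CStarAlgebra.pow_antitone hB0 hB1 (Nat.succ_le_succ hmn)) _)
    · refine fun n => pullback_nonneg (sub_nonneg.mpr ?_)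
      simpa using CStarAlgebra.pow_antitone hB0 hB1 (Nat.le_add_left 1 n)
    · refine fun n => ⟨n, n.cast_nonneg, ?_⟩
      rw [hTB, ← pullback_smul]
      exact pullback_mono (sub_pow_succ_le hB0 hB1 n)
    · intro x
      have h1 := (hlim (J x)).comp (tendsto_add_atTop_nat 1)
      have h2 := (tendsto_const_nhds (x := B (J x))).sub h1
      exact ((ContinuousLinearMap.adjoint J).continuous.tendsto _).comp h2
  · have h0 : MutuallySingularOperators (P + 0) (1 - B) :=
      MutuallySingularOperators.fixedProjection_add hP hBP le_rfl (zero_mul _)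
        fun D hD hD0 _ => le_antisymm hD0 hD
    rw [add_zero] at h0
    rw [hSB, ← pullback_sub, sub_sub_cancel, hTB]
    exact h0.pullback hJ hN1
  · intro R hR hRS hRT
    obtain ⟨D, hD, rfl⟩ := exists_eq_pullback hJ hR
      (hRS.trans (by rw [hSB]; exact pullback_mono hB1))
    rw [hSB, pullback_le_iff hJ] at hRS
    rw [hTB] at hRT
    refine pullback_mono (operator_le_iff.mpr fun x => ?_)
    have hDP : D (P x) = 0 := hRT.apply_eq_zero hJ hD (congr($hBP x))
    have hGP' : (B - P) (P x) = 0 := congr($hGP x)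
    have hPP : P (P x) = P x := congr($(hP.isIdempotentElem.eq) x)
    rw [← inner_sub_apply_of_apply_eq_zero hD hDP, ← inner_sub_apply_of_apply_eq_zero hG hGP']
    refine (operator_le_iff.mp hRS _).trans_eq ?_
    rw [sub_apply, map_sub P, hPP, sub_self, sub_zero]
  · by_cases h : ∃ c : ℝ, 0 < c ∧ B - P ≤ (c : ℂ) • (1 - B)
    · obtain ⟨c, hc, h⟩ := h
      refine Or.inl ⟨c, hc, ?_⟩
      rw [hTB, ← pullback_smul]
      exact pullback_mono h
    · obtain ⟨A, hA, hA0, hAG, hAN⟩ := exists_singular_perturbation hB0 hB1 hP hBP h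
      refine Or.inr ⟨pullback J (B - P - A), ?_, pullback_mono (sub_le_self _ hA), ?_, ?_⟩
      · rw [← pullback_smul]
        refine pullback_mono (le_sub_iff_add_le.mpr ((add_le_add_right hAG _).trans_eq ?_))
        rw [← add_smul, ← Complex.ofReal_add]
        norm_num
      · intro heq
        exact hA0 (by simpa using pullback_injective hJ heq)
      · rw [hSB, ← pullback_sub, hTB, show B - (B - P - A) = P + A by abel]
        exact hAN.pullback hJ hN1

end AbsolutelyContinuousPart

/-! ### Positive functionals on `*`-algebras -/

section PositiveFunctionals

variable {A : Type*} [Ring A] [StarRing A] [Algebra ℂ A] {f g h k : A →ₗ[ℂ] ℂ}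

lemma IsPositiveFunctional.add (hf : IsPositiveFunctional f) (hg : IsPositiveFunctional g) :
    IsPositiveFunctional (f + g) := fun a => add_nonneg (hf a) (hg a)

lemma IsPositiveFunctional.smul (hf : IsPositiveFunctional f) {c : ℝ} (hc : 0 ≤ c) :
    IsPositiveFunctional ((c : ℂ) • f) := fun a =>
  mul_nonneg (Complex.zero_le_real.mpr hc) (hf a)

lemma functionalLE_iff : FunctionalLE g f ↔ ∀ a, g (star a * a) ≤ f (star a * a) := by
  simp [FunctionalLE, IsPositiveFunctional]

lemma IsPositiveFunctional.apply_eq_ofReal (hf : IsPositiveFunctional f) (a : A) :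
    f (star a * a) = ((f (star a * a)).re : ℂ) :=
  Complex.ext rfl (Complex.nonneg_iff.mp (hf a)).2.symm

lemma IsPositiveFunctional.re_nonneg (hf : IsPositiveFunctional f) (a : A) :
    0 ≤ (f (star a * a)).re := (Complex.nonneg_iff.mp (hf a)).1

lemma FunctionalLE.re_le (h : FunctionalLE g f) (a : A) :
    (g (star a * a)).re ≤ (f (star a * a)).re :=
  (Complex.le_def.mp (functionalLE_iff.mp h a)).1

lemma IsPositiveFunctional.tendsto_zero_iff (hf : IsPositiveFunctional f) {ι : Type*}
    {l : Filter ι} {a : ι → A} :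
    Tendsto (fun i => f (star (a i) * a i)) l (𝓝 0) ↔
      Tendsto (fun i => (f (star (a i) * a i)).re) l (𝓝 0) := by
  constructor
  · intro h
    have h1 := (Complex.continuous_re.tendsto _).comp h
    rw [Complex.zero_re] at h1
    exact h1
  · intro h
    have h1 := (Complex.continuous_ofReal.tendsto _).comp h
    rw [Complex.ofReal_zero] at h1
    exact h1.congr fun i => (hf.apply_eq_ofReal (a i)).symm

lemma IsPositiveFunctional.re_le_two_mul_add (hf : IsPositiveFunctional f) (a b : A) :
    (f (star a * a)).re ≤
      2 * (f (star (a - b) * (a - b))).re + 2 * (f (star b * b)).re := by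
  have h1 : star (a - b - b) * (a - b - b) + star a * a =
      (2 : ℂ) • (star (a - b) * (a - b)) + (2 : ℂ) • (star b * b) := by
    simp only [star_sub, two_smul]
    noncomm_ring
  have h2 := congr((f $h1).re)
  rw [map_add, map_add, map_smul, map_smul] at h2
  have h3 := hf.re_nonneg (a - b - b)
  simp only [Complex.add_re, smul_eq_mul, Complex.mul_re, Complex.re_ofNat, Complex.im_ofNat,
    zero_mul, sub_zero] at h2
  linarith

/-- A functional that is the pointwise limit, on the elements `a* a`, of `f`-dominated
functionals below it is `f`-closable. -/
lemma isClosableWrt_of_tendsto (hf : IsPositiveFunctional f) (hg : IsPositiveFunctional g)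
    {u : ℕ → A →ₗ[ℂ] ℂ} (hu : ∀ k, IsPositiveFunctional (u k))
    (huf : ∀ k, ∃ c : ℝ, FunctionalLE (u k) ((c : ℂ) • f)) (hug : ∀ k, FunctionalLE (u k) g)
    (hlim : ∀ a, Tendsto (fun k => (u k (star a * a)).re) atTop (𝓝 (g (star a * a)).re)) :
    IsClosableWrt f g := by
  intro a hfa hga
  rw [hf.tendsto_zero_iff] at hfa
  rw [hg.tendsto_zero_iff] at hga ⊢
  rw [Metric.tendsto_atTop]
  intro ε hε
  obtain ⟨⟨N₁, N₂⟩, hN⟩ := eventually_atTop.mp (hga.eventually_lt_const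
    (show (0 : ℝ) < ε / 4 by positivity))
  refine ⟨max N₁ N₂, fun n hn => ?_⟩
  rw [Real.dist_0_eq_abs, abs_of_nonneg (hg.re_nonneg _)]
  -- each `u k` tends to `0` along `a`, so `m → ∞` bounds `u k` at `a n` uniformly in `k`
  have hk : ∀ k, (u k (star (a n) * a n)).re ≤ ε / 2 := by
    intro k
    have hum : Tendsto (fun m => (u k (star (a m) * a m)).re) atTop (𝓝 0) := by
      obtain ⟨c, hc⟩ := huf k
      have h0 : Tendsto (fun m => c * (f (star (a m) * a m)).re) atTop (𝓝 0) := by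
        simpa using hfa.const_mul c
      refine squeeze_zero (fun m => (hu k).re_nonneg _) (fun m => ?_) h0
      simpa using hc.re_le (a m)
    have h1 : Tendsto (fun m => 2 * (ε / 4) + 2 * (u k (star (a m) * a m)).re) atTop
        (𝓝 (2 * (ε / 4) + 2 * 0)) := tendsto_const_nhds.add (hum.const_mul 2)
    have h2 : (u k (star (a n) * a n)).re ≤ 2 * (ε / 4) + 2 * 0 := by
      refine ge_of_tendsto h1 ((eventually_ge_atTop (max N₁ N₂)).mono fun m hm => ?_)
      have h3 := (hu k).re_le_two_mul_add (a n) (a m)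
      have h4 := (hug k).re_le (a n - a m)
      have h5 := hN (n, m) ⟨(le_max_left _ _).trans hn, (le_max_right _ _).trans hm⟩
      linarith
    linarith
  have := le_of_tendsto' (hlim (a n)) hk
  linarith

/-- A functional comparable to a closable one is closable. -/
lemma IsClosableWrt.of_le_of_smul_le (hg : IsPositiveFunctional g) (hh : IsPositiveFunctional h)
    (hclos : IsClosableWrt f g) (hhg : FunctionalLE h g) {c : ℝ} (hc : 0 < c)
    (hgh : FunctionalLE ((c : ℂ) • g) h) : IsClosableWrt f h := by
  intro a hfa hha
  have hle : ∀ b, (g (star b * b)).re ≤ c⁻¹ * (h (star b * b)).re := by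
    intro b
    rw [← mul_le_mul_iff_right₀ hc, mul_inv_cancel_left₀ hc.ne']
    simpa using hgh.re_le b
  rw [hh.tendsto_zero_iff] at hha ⊢
  have h1 := hclos a hfa (hg.tendsto_zero_iff.mpr
    (squeeze_zero (fun p => hg.re_nonneg _) (fun p => hle _) (by simpa using hha.const_mul c⁻¹)))
  exact squeeze_zero (fun n => hh.re_nonneg _) (fun n => hhg.re_le _)
    (hg.tendsto_zero_iff.mp h1)

/-- If the regular part is dominated by `f`, then its difference with the closable part of another
decomposition is dominated both by `f` and by the singular part, hence vanishes. -/
lemma IsRegularPart.hasUniqueLebesgueDecomposition {r : A →ₗ[ℂ] ℂ} (hf : IsPositiveFunctional f)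
    (hr : IsRegularPart f g r) {c : ℝ} (hc : 0 < c) (hrf : FunctionalLE r ((c : ℂ) • f)) :
    HasUniqueLebesgueDecomposition f g := by
  refine ⟨(r, g - r), hr.decomposition, ?_⟩
  rintro ⟨g₀, g₁⟩ hd
  obtain ⟨hg₀, hg₁, hadd, hclos, hsing⟩ := hd
  dsimp only at hg₀ hg₁ hadd hclos hsing
  have h₀ : FunctionalLE g₀ r := hr.extremal g₀ hg₀ hclos (by
    rw [FunctionalLE, hadd, add_sub_cancel_left]; exact hg₁)
  have hgr : IsPositiveFunctional (g - r) := hr.decomposition.pos_singular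
  -- `(c + 1)⁻¹ (r - g₀)` is below `f` since `r ≤ c f`, and below `g₁` since `r ≤ g = g₀ + g₁`
  have hc1 : ((c : ℂ) + 1) ≠ 0 := by exact_mod_cast (by positivity : c + 1 ≠ 0)
  have hinv : (((c + 1)⁻¹ : ℝ) : ℂ) = ((c : ℂ) + 1)⁻¹ := by push_cast; rfl
  have hpos : 0 ≤ (c + 1)⁻¹ := by positivity
  have hk := hsing ((((c + 1)⁻¹ : ℝ) : ℂ) • (r - g₀)) (h₀.smul hpos) ?_ ?_
  · have h1 : r - g₀ = 0 := by
      rw [hinv] at hk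
      exact (smul_eq_zero.mp hk).resolve_left (inv_ne_zero hc1)
    have h2 : g₀ = r := (sub_eq_zero.mp h1).symm
    rw [Prod.mk.injEq]
    exact ⟨h2, by rw [hadd, h2, add_sub_cancel_left]⟩
  · have h1 : f - (((c + 1)⁻¹ : ℝ) : ℂ) • (r - g₀) =
        (((c + 1)⁻¹ : ℝ) : ℂ) • (((c : ℂ) • f - r) + (f + g₀)) := by
      rw [hinv]
      have : f = ((c : ℂ) + 1)⁻¹ • (((c : ℂ) + 1) • f) := (inv_smul_smul₀ hc1 f).symm
      conv_lhs => rw [this]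
      rw [← smul_sub, add_smul, one_smul]
      congr 1
      abel
    rw [FunctionalLE, h1]
    exact (hrf.add (hf.add hg₀)).smul hpos
  · have h1 : g₁ - (((c + 1)⁻¹ : ℝ) : ℂ) • (r - g₀) =
        (((c + 1)⁻¹ : ℝ) : ℂ) • ((c : ℂ) • g₁ + (g - r)) := by
      rw [hinv]
      have : g₁ = ((c : ℂ) + 1)⁻¹ • (((c : ℂ) + 1) • g₁) := (inv_smul_smul₀ hc1 g₁).symm
      conv_lhs => rw [this]
      rw [← smul_sub, add_smul, one_smul, hadd]
      congr 1
      abel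
    rw [FunctionalLE, h1]
    exact ((hg₁.smul hc.le).add hgr).smul hpos

end PositiveFunctionals

/-! ### Positive functionals on C*-algebras -/

section CStar

variable {A : Type*} [CStarAlgebra A] [PartialOrder A] [StarOrderedRing A] {h k : A →ₗ[ℂ] ℂ}

lemma IsPositiveFunctional.apply_nonneg (hh : IsPositiveFunctional h) {a : A} (ha : 0 ≤ a) :
    0 ≤ h a := by
  obtain ⟨b, rfl⟩ := CStarAlgebra.nonneg_iff_eq_star_mul_self.mp ha
  exact hh b

lemma IsPositiveFunctional.norm_apply_star_mul_sq_le (hh : IsPositiveFunctional h) (a b : A) :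
    ‖h (star a * b)‖ ^ 2 ≤ (h (star a * a)).re * (h (star b * b)).re := by
  let φ : A →ₚ[ℂ] ℂ := PositiveLinearMap.mk₀ h fun _ => hh.apply_nonneg
  have h1 := norm_inner_le_norm (𝕜 := ℂ) (φ.toPreGNS a) (φ.toPreGNS b)
  have h2 : ∀ x, ‖φ.toPreGNS x‖ ^ 2 = (h (star x * x)).re := by
    intro x
    have := φ.preGNS_norm_sq (φ.toPreGNS x)
    rw [φ.ofPreGNS_toPreGNS] at this
    have h3 : ((‖φ.toPreGNS x‖ ^ 2 : ℝ) : ℂ) = h (star x * x) := by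
      push_cast; exact this
    rw [← h3, Complex.ofReal_re]
  rw [← h2, ← h2, ← mul_pow]
  exact pow_le_pow_left₀ (norm_nonneg _) h1 2

lemma IsPositiveFunctional.re_apply_star_mul_self_le (hh : IsPositiveFunctional h) (a : A) :
    (h (star a * a)).re ≤ ‖a‖ ^ 2 * (h 1).re := by
  have h1 := hh.apply_nonneg
    (sub_nonneg.mpr (CStarAlgebra.star_mul_le_algebraMap_norm_sq (a := a)))
  rw [map_sub] at h1
  have h2 := (Complex.nonneg_iff.mp h1).1
  rw [Algebra.algebraMap_eq_smul_one] at h2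
  rw [← Complex.coe_smul, map_smul] at h2
  simpa [← Complex.ofReal_pow] using h2

lemma FunctionalLE.antisymm (h₁ : FunctionalLE h k) (h₂ : FunctionalLE k h) : h = k := by
  rw [functionalLE_iff] at h₂
  have h3 : k - h = 0 := by
    ext a
    have h4 : (k - h) (star a * a) = 0 :=
      le_antisymm (by simpa using h₂ a) (h₁ a)
    have h5 := IsPositiveFunctional.norm_apply_star_mul_sq_le h₁ 1 a
    rw [h4, Complex.zero_re, mul_zero, star_one, one_mul] at h5
    simpa using le_antisymm h5 (sq_nonneg _)
  exact (sub_eq_zero.mp h3).symm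

end CStar

/-! ### Normal positive functionals and their densities -/

section Density

variable {H : Type*} [NormedAddCommGroup H] [InnerProductSpace ℂ H] [CompleteSpace H]
  {h k : (H →L[ℂ] H) →ₗ[ℂ] ℂ} {R R' : H →L[ℂ] H}

/-- `R` is the density of the normal positive functional `h`: `R` represents `h` on rank one
operators, and `h 1` is the trace of `R`. -/
structure HasDensity (h : (H →L[ℂ] H) →ₗ[ℂ] ℂ) (R : H →L[ℂ] H) : Prop where
  pos : IsPositiveFunctional h
  apply_rankOne : ∀ x y, h (InnerProductSpace.rankOne ℂ x y) = ⟪y, R x⟫_ℂ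
  hasSum_one : HasSum (fun e : basisSet H => ⟪orthonormalBasis H e, R (orthonormalBasis H e)⟫_ℂ)
    (h 1)

lemma HasDensity.nonneg (hR : HasDensity h R) : 0 ≤ R := by
  rw [operator_nonneg_iff]
  intro x
  rw [← hR.apply_rankOne]
  exact hR.pos.apply_nonneg (rankOne_self_nonneg x)

lemma HasDensity.density_unique (hR : HasDensity h R) (hR' : HasDensity h R') : R = R' := by
  ext x
  refine ext_inner_left ℂ fun y => ?_
  rw [← hR.apply_rankOne, hR'.apply_rankOne]

lemma isSelfAdjoint_rankOne_self (x : H) : IsSelfAdjoint (InnerProductSpace.rankOne ℂ x x) :=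
  IsSelfAdjoint.of_nonneg (rankOne_self_nonneg x)

/-- The projection onto the span of finitely many vectors of the fixed orthonormal basis. -/
noncomputable def basisProjection (F : Finset (basisSet H)) : H →L[ℂ] H :=
  ∑ e ∈ F, InnerProductSpace.rankOne ℂ (orthonormalBasis H e) (orthonormalBasis H e)

lemma isStarProjection_basisProjection (F : Finset (basisSet H)) :
    IsStarProjection (basisProjection F) := by
  refine ⟨?_, ?_⟩
  · rw [IsIdempotentElem, basisProjection, Finset.sum_mul_sum]
    refine Finset.sum_congr rfl fun e he => ?_
    rw [Finset.sum_eq_single e]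
    · ext x
      simp [(orthonormalBasis H).orthonormal.norm_eq_one e]
    · intro e' _ hne
      ext x
      simp [(orthonormalBasis H).orthonormal.inner_eq_zero hne.symm]
    · exact fun h => absurd he h
  · exact isSelfAdjoint_sum _ fun e _ => isSelfAdjoint_rankOne_self _

lemma apply_basisProjection_mul
    (hrank : ∀ x y, h (InnerProductSpace.rankOne ℂ x y) = ⟪y, R x⟫_ℂ)
    (F : Finset (basisSet H)) (A : H →L[ℂ] H) :
    h (basisProjection F * A) =
      ∑ e ∈ F, ⟪orthonormalBasis H e, A (R (orthonormalBasis H e))⟫_ℂ := by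
  rw [basisProjection, Finset.sum_mul, map_sum]
  refine Finset.sum_congr rfl fun e _ => ?_
  rw [ContinuousLinearMap.mul_def, InnerProductSpace.rankOne_comp, hrank,
    ContinuousLinearMap.adjoint_inner_left]

lemma HasDensity.tendsto_apply_one_sub_basisProjection (hR : HasDensity h R) :
    Tendsto (fun F : Finset (basisSet H) => (h (1 - basisProjection F)).re) atTop (𝓝 0) := by
  have h2 : Tendsto (fun F : Finset (basisSet H) => h (1 - basisProjection F)) atTop
      (𝓝 (h 1 - h 1)) := by
    simp only [map_sub h]
    refine tendsto_const_nhds.sub (Tendsto.congr (fun F => ?_) hR.hasSum_one)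
    simpa using (apply_basisProjection_mul hR.apply_rankOne F 1).symm
  rw [sub_self] at h2
  have h3 := (Complex.continuous_re.tendsto _).comp h2
  rw [Complex.zero_re] at h3
  exact h3

/-- The Cauchy-Schwarz inequality `‖h ((1 - P) A)‖² ≤ h (1 - P) h (A* A)` lets the value at `A` be
computed from the finite rank operators `P A`. -/
lemma HasDensity.hasSum_apply (hR : HasDensity h R) (A : H →L[ℂ] H) :
    HasSum (fun e : basisSet H => ⟪orthonormalBasis H e, A (R (orthonormalBasis H e))⟫_ℂ)
      (h A) := by
  have h4 : Tendsto (fun F : Finset (basisSet H) => ‖h ((1 - basisProjection F) * A)‖ ^ 2) atTop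
      (𝓝 0) := by
    have h1 := hR.tendsto_apply_one_sub_basisProjection.mul_const (h (star A * A)).re
    rw [zero_mul] at h1
    refine squeeze_zero (fun F => sq_nonneg _) (fun F => ?_) h1
    have hP := (isStarProjection_basisProjection F).one_sub
    have h5 := hR.pos.norm_apply_star_mul_sq_le (1 - basisProjection F) A
    rwa [hP.isSelfAdjoint.star_eq, hP.isIdempotentElem.eq] at h5
  have h5 : Tendsto (fun F : Finset (basisSet H) => h ((1 - basisProjection F) * A)) atTop
      (𝓝 0) := by
    rw [tendsto_zero_iff_norm_tendsto_zero]
    simpa [Real.sqrt_sq] using h4.sqrt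
  have h6 := h5.const_sub (h A)
  rw [sub_zero] at h6
  refine Tendsto.congr (fun F => ?_) h6
  rw [← apply_basisProjection_mul hR.apply_rankOne, ← map_sub]
  congr 1
  noncomm_ring

lemma HasDensity.functional_unique (hh : HasDensity h R) (hk : HasDensity k R) : h = k := by
  ext A
  exact (hh.hasSum_apply A).unique (hk.hasSum_apply A)

lemma HasDensity.add (hh : HasDensity h R) (hk : HasDensity k R') :
    HasDensity (h + k) (R + R') where
  pos := hh.pos.add hk.pos
  apply_rankOne x y := by
    simp [hh.apply_rankOne, hk.apply_rankOne]
  hasSum_one := by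
    simpa [inner_add_right] using hh.hasSum_one.add hk.hasSum_one

lemma HasDensity.smul (hh : HasDensity h R) {c : ℝ} (hc : 0 ≤ c) :
    HasDensity ((c : ℂ) • h) ((c : ℂ) • R) where
  pos := hh.pos.smul hc
  apply_rankOne x y := by
    simp [hh.apply_rankOne]
  hasSum_one := by
    simpa [inner_smul_right] using hh.hasSum_one.mul_left (c : ℂ)

lemma HasDensity.sub (hh : HasDensity h R) (hk : HasDensity k R') (hkh : FunctionalLE k h) :
    HasDensity (h - k) (R - R') where
  pos := hkh
  apply_rankOne x y := by
    simp [hh.apply_rankOne, hk.apply_rankOne]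
  hasSum_one := by
    simpa [inner_sub_right] using hh.hasSum_one.sub hk.hasSum_one

lemma HasDensity.summable_norm_sq (hh : HasDensity h R) :
    Summable fun e : basisSet H => ‖CFC.sqrt R (orthonormalBasis H e)‖ ^ 2 := by
  have h1 := hh.hasSum_one.summable
  simp only [inner_eq_norm_sqrt_sq hh.nonneg, ← Complex.ofReal_pow] at h1
  exact Complex.summable_ofReal.mp h1

/-- A positive operator `R` below the density of a functional is the density of the functional
`A ↦ ∑ ⟪√R e, A (√R e)⟫`. -/
lemma HasDensity.exists_of_le (hk : HasDensity k R') (hR : 0 ≤ R) (hRR : R ≤ R') :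
    ∃ h : (H →L[ℂ] H) →ₗ[ℂ] ℂ, HasDensity h R := by
  set s := CFC.sqrt R with hs
  set b := orthonormalBasis H
  have hsum : Summable fun e : basisSet H => ‖s (b e)‖ ^ 2 := by
    refine hk.summable_norm_sq.of_nonneg_of_le (fun e => sq_nonneg _) fun e => ?_
    have h1 := operator_le_iff.mp hRR (b e)
    rw [inner_eq_norm_sqrt_sq hR, inner_eq_norm_sqrt_sq hk.nonneg] at h1
    exact_mod_cast h1
  have hsumA : ∀ A : H →L[ℂ] H, Summable fun e : basisSet H => ⟪s (b e), A (s (b e))⟫_ℂ := by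
    intro A
    refine (hsum.mul_left ‖A‖).of_norm_bounded fun e => ?_
    calc ‖⟪s (b e), A (s (b e))⟫_ℂ‖ ≤ ‖s (b e)‖ * ‖A (s (b e))‖ := norm_inner_le_norm _ _
      _ ≤ ‖s (b e)‖ * (‖A‖ * ‖s (b e)‖) := by gcongr; exact A.le_opNorm _
      _ = ‖A‖ * ‖s (b e)‖ ^ 2 := by ring
  let φ : (H →L[ℂ] H) →ₗ[ℂ] ℂ :=
    { toFun := fun A => ∑' e : basisSet H, ⟪s (b e), A (s (b e))⟫_ℂ
      map_add' := fun A B => by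
        rw [← (hsumA A).tsum_add (hsumA B)]
        simp
      map_smul' := fun c A => by
        rw [RingHom.id_apply, smul_eq_mul, ← tsum_mul_left]
        simp }
  have hφ : ∀ A, φ A = ∑' e : basisSet H, ⟪s (b e), A (s (b e))⟫_ℂ := fun _ => rfl
  have hinner : ∀ x y, ⟪s x, s y⟫_ℂ = ⟪x, R y⟫_ℂ := by
    intro x y
    rw [hs, inner_sqrt_left]
    conv_rhs => rw [← CFC.sqrt_mul_sqrt_self R hR]
    rfl
  refine ⟨φ, fun A => ?_, fun x y => ?_, ?_⟩
  · rw [hφ]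
    refine tsum_nonneg fun e => ?_
    rw [mul_apply_eq_comp, ContinuousLinearMap.star_eq_adjoint,
      ContinuousLinearMap.adjoint_inner_right]
    exact operator_nonneg_iff.mp zero_le_one (A (s (b e)))
  · rw [hφ, ← hinner, ← (b.hasSum_inner_mul_inner (s y) (s x)).tsum_eq]
    refine tsum_congr fun e => ?_
    rw [InnerProductSpace.rankOne_apply, inner_smul_right, hs, inner_sqrt_left,
      ← inner_sqrt_left _ y]
  · simp only [← hinner, hφ]
    exact (hsumA 1).hasSum

lemma HasDensity.functionalLE_iff (hh : HasDensity h R) (hk : HasDensity k R') :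
    FunctionalLE h k ↔ R ≤ R' := by
  refine ⟨fun hle => sub_nonneg.mp (hk.sub hh hle).nonneg, fun hle => ?_⟩
  obtain ⟨d, hd⟩ := hk.exists_of_le (sub_nonneg.mpr hle) (sub_le_self R' hh.nonneg)
  have h1 := hh.add hd
  rw [add_sub_cancel] at h1
  rw [FunctionalLE, hk.functional_unique h1, add_sub_cancel_left]
  exact hd.pos

/-- A positive functional below a normal one is normal. -/
lemma HasDensity.exists_density_of_functionalLE (hk : HasDensity k R')
    (hh : IsPositiveFunctional h) (hhk : FunctionalLE h k) :
    ∃ R : H →L[ℂ] H, R ≤ R' ∧ HasDensity h R := by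
  have hbound : ∀ A, ‖h A‖ ≤ (h 1).re * ‖A‖ := by
    intro A
    have h1 : 0 ≤ (h 1).re := (Complex.nonneg_iff.mp (hh.apply_nonneg zero_le_one)).1
    have h2 := hh.norm_apply_star_mul_sq_le 1 A
    have h3 := hh.re_apply_star_mul_self_le A
    rw [star_one, one_mul, one_mul] at h2
    refine le_of_sq_le_sq ?_ (by positivity)
    nlinarith
  let hc : (H →L[ℂ] H) →L[ℂ] ℂ := h.mkContinuous _ hbound
  let β : H →L⋆[ℂ] H →L[ℂ] ℂ := (ContinuousLinearMap.compL ℂ H (H →L[ℂ] H) ℂ hc).comp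
    (InnerProductSpace.rankOne ℂ : H →L[ℂ] H →L⋆[ℂ] H →L[ℂ] H).flip
  let R : H →L[ℂ] H :=
    ContinuousLinearMap.adjoint (InnerProductSpace.continuousLinearMapOfBilin β)
  have hrank : ∀ x y, h (InnerProductSpace.rankOne ℂ x y) = ⟪y, R x⟫_ℂ := by
    intro x y
    rw [ContinuousLinearMap.adjoint_inner_right,
      InnerProductSpace.continuousLinearMapOfBilin_apply]
    rfl
  have hR : HasDensity h R := by
    refine ⟨hh, hrank, ?_⟩
    have h1 : Tendsto (fun F : Finset (basisSet H) => h (1 - basisProjection F)) atTop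
        (𝓝 0) := by
      have hP := fun F : Finset (basisSet H) => (isStarProjection_basisProjection F).one_sub
      have hPP : ∀ F : Finset (basisSet H), 1 - basisProjection F =
          star (1 - basisProjection F) * (1 - basisProjection F) := fun F => by
        rw [(hP F).isSelfAdjoint.star_eq, (hP F).isIdempotentElem.eq]
      have h2 := hk.tendsto_apply_one_sub_basisProjection
      refine Tendsto.congr (fun F => by rw [hPP]) ((hh.tendsto_zero_iff).mpr
        (squeeze_zero (fun F => hh.re_nonneg _) (fun F => ?_) h2))
      conv_rhs => rw [hPP]
      exact hhk.re_le _
    have h3 := h1.const_sub (h 1)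
    rw [sub_zero] at h3
    refine Tendsto.congr (fun F => ?_) h3
    have h4 := apply_basisProjection_mul hrank F 1
    rw [mul_one] at h4
    rw [← map_sub, sub_sub_cancel, h4]
    rfl
  exact ⟨R, sub_nonneg.mp (hk.sub hR hhk).nonneg, hR⟩

end Density

/-! ### Transfer between operators and functionals -/

section Transfer

variable {H : Type*} [NormedAddCommGroup H] [InnerProductSpace ℂ H] [CompleteSpace H]
  {f g h : (H →L[ℂ] H) →ₗ[ℂ] ℂ} {T S R : H →L[ℂ] H}

lemma IsNormalFunctionalOf.hasDensity (hf : IsPositiveFunctional f)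
    (hfT : IsNormalFunctionalOf f T) : HasDensity f T := by
  have hrank : ∀ x y, f (InnerProductSpace.rankOne ℂ x y) = ⟪y, T x⟫_ℂ := by
    intro x y
    rw [hfT.apply_eq, trace, ← ContinuousLinearMap.adjoint_inner_left,
      ← ((orthonormalBasis H).hasSum_inner_mul_inner _ _).tsum_eq]
    refine tsum_congr fun e => ?_
    rw [mul_apply_eq_comp, InnerProductSpace.rankOne_apply, inner_smul_right,
      ContinuousLinearMap.adjoint_inner_left]
  have hT : 0 ≤ T := by
    rw [operator_nonneg_iff]
    intro x
    rw [← hrank]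
    exact hf.apply_nonneg (rankOne_self_nonneg x)
  refine ⟨hf, hrank, ?_⟩
  have h1 := hfT.traceClass
  rw [IsTraceClass, CFC.abs_of_nonneg T hT] at h1
  rw [hfT.apply_eq, one_mul]
  exact h1.hasSum

lemma OperatorAbsolutelyContinuous.isClosableWrt (hfT : HasDensity f T) (hR : HasDensity h R)
    (hRT : OperatorAbsolutelyContinuous R T) : IsClosableWrt f h := by
  obtain ⟨Q, hQmono, hQ0, hQT, hQlim⟩ := hRT
  have hinner : ∀ x, Tendsto (fun n => ⟪x, Q n x⟫_ℂ) atTop (𝓝 ⟪x, R x⟫_ℂ) := fun x =>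
    tendsto_const_nhds.inner (hQlim x)
  have hQR : ∀ n, Q n ≤ R := by
    intro n
    rw [operator_le_iff]
    intro x
    exact ge_of_tendsto (hinner x)
      ((eventually_ge_atTop n).mono fun m hm => operator_le_iff.mp (hQmono hm) x)
  choose u hu using fun n => hR.exists_of_le (hQ0 n) (hQR n)
  have hur : ∀ n, FunctionalLE (u n) h := fun n => ((hu n).functionalLE_iff hR).mpr (hQR n)
  refine isClosableWrt_of_tendsto hfT.pos hR.pos (fun n => (hu n).pos) (fun n => ?_) hur
    fun a => ?_
  · obtain ⟨c, hc, hle⟩ := hQT n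
    exact ⟨c, ((hu n).functionalLE_iff (hfT.smul hc)).mpr hle⟩
  · -- the traces converge by dominated convergence, and they control `h - u n`
    have h1 : Tendsto (fun n => u n 1) atTop (𝓝 (h 1)) := by
      rw [← hR.hasSum_one.tsum_eq]
      simp only [← (hu _).hasSum_one.tsum_eq]
      refine tendsto_tsum_of_dominated_convergence hR.hasSum_one.summable.norm
        (fun e => hinner _) (Eventually.of_forall fun n e => ?_)
      exact CStarAlgebra.norm_le_norm_of_nonneg_of_le (operator_nonneg_iff.mp (hQ0 n) _)
        (operator_le_iff.mp (hQR n) _)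
    have h2 : Tendsto (fun n => ‖a‖ ^ 2 * ((h - u n) 1).re) atTop (𝓝 0) := by
      have h3 := (Complex.continuous_re.tendsto _).comp (h1.const_sub (h 1))
      rw [sub_self, Complex.zero_re] at h3
      simpa using h3.const_mul (‖a‖ ^ 2)
    have h4 : Tendsto (fun n => ((h - u n) (star a * a)).re) atTop (𝓝 0) :=
      squeeze_zero (fun n => IsPositiveFunctional.re_nonneg (hur n) a)
        (fun n => IsPositiveFunctional.re_apply_star_mul_self_le (hur n) a) h2
    have h5 := h4.const_sub (h (star a * a)).re
    rw [sub_zero] at h5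
    exact h5.congr fun n => by rw [LinearMap.sub_apply, Complex.sub_re, sub_sub_cancel]

/-- Closability of functionals is tested on the rank one operators `|u⟩⟨xₙ|`. -/
lemma IsClosableWrt.isFormClosableWrt (hfT : HasDensity f T) (hR : HasDensity h R)
    (hclos : IsClosableWrt f h) : IsFormClosableWrt T R := by
  intro x hT hx
  rcases subsingleton_or_nontrivial H with hH | hH
  · have : ∀ n, x n = 0 := fun n => Subsingleton.elim _ _
    simp [this]
  obtain ⟨w, hw⟩ := exists_ne (0 : H)
  have hu : ⟪w, w⟫_ℂ ≠ 0 := inner_self_ne_zero.mpr hw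
  have key : ∀ {k : (H →L[ℂ] H) →ₗ[ℂ] ℂ} {D : H →L[ℂ] H}, HasDensity k D → ∀ y : H,
      k (star (InnerProductSpace.rankOne ℂ w y) * InnerProductSpace.rankOne ℂ w y) =
        ⟪w, w⟫_ℂ * ⟪y, D y⟫_ℂ := by
    intro k D hk y
    rw [ContinuousLinearMap.star_eq_adjoint, InnerProductSpace.adjoint_rankOne,
      ContinuousLinearMap.mul_def, InnerProductSpace.rankOne_comp_rankOne, map_smul,
      hk.apply_rankOne, smul_eq_mul]
  have h1 := hclos (fun n => InnerProductSpace.rankOne ℂ w (x n)) ?_ ?_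
  · simp only [key hR] at h1
    have h2 := h1.const_mul (⟪w, w⟫_ℂ)⁻¹
    simp only [inv_mul_cancel_left₀ hu, mul_zero] at h2
    exact h2
  · simp only [key hfT]
    simpa using hT.const_mul ⟪w, w⟫_ℂ
  · simp only [← map_sub, key hR]
    simpa using hx.const_mul ⟪w, w⟫_ℂ

lemma MutuallySingularOperators.mutuallySingularFunctionals (hfT : HasDensity f T)
    (hgS : HasDensity g S) (h : MutuallySingularOperators S T) :
    MutuallySingularFunctionals f g := by
  intro k hk hkf hkg
  obtain ⟨D, hDT, hD⟩ := hfT.exists_density_of_functionalLE hk hkf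
  have hD0 := h D hD.nonneg ((hD.functionalLE_iff hgS).mp hkg) hDT
  subst hD0
  ext A
  simpa using (hD.hasSum_apply A).tsum_eq.symm

end Transfer

/-! ### Uniqueness of the regular and absolutely continuous parts -/

section RegularPart

lemma IsRegularPart.regularPart_eq {A : Type*} [CStarAlgebra A] [PartialOrder A]
    [StarOrderedRing A] {f g r : A →ₗ[ℂ] ℂ} (hr : IsRegularPart f g r) :
    regularPart f g = r := by
  have hex : ∃ r, IsRegularPart f g r := ⟨r, hr⟩
  rw [regularPart, dif_pos hex]
  exact FunctionalLE.antisymm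
    (hr.extremal _ hex.choose_spec.decomposition.pos_closable
      hex.choose_spec.decomposition.closable
      hex.choose_spec.decomposition.pos_singular)
    (hex.choose_spec.extremal _ hr.decomposition.pos_closable hr.decomposition.closable
      hr.decomposition.pos_singular)

lemma IsAbsolutelyContinuousPart.absolutelyContinuousPart_eq {H : Type*} [NormedAddCommGroup H]
    [InnerProductSpace ℂ H] {T S W : H →L[ℂ] H} (hW : IsAbsolutelyContinuousPart T S W) :
    absolutelyContinuousPart T S = W := by
  have hex : ∃ W, IsAbsolutelyContinuousPart T S W := ⟨W, hW⟩
  rw [absolutelyContinuousPart, dif_pos hex]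
  have h := hex.choose_spec
  exact le_antisymm (hW.extremal _ h.nonneg h.absolutelyContinuous h.le)
    (h.extremal _ hW.nonneg hW.absolutelyContinuous hW.le)

end RegularPart

end LebesgueDecomposition

open LebesgueDecomposition

theorem mainTheorem3 {H : Type*} [NormedAddCommGroup H] [InnerProductSpace ℂ H] [CompleteSpace H]
    (f g : (H →L[ℂ] H) →ₗ[ℂ] ℂ) (T S : H →L[ℂ] H)
    (hf : LebesgueDecomposition.IsPositiveFunctional f)
    (hg : LebesgueDecomposition.IsPositiveFunctional g)
    (hfT : LebesgueDecomposition.IsNormalFunctionalOf f T)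
    (hgS : LebesgueDecomposition.IsNormalFunctionalOf g S) :
    LebesgueDecomposition.IsRegularPart f g (LebesgueDecomposition.regularPart f g) ∧
    LebesgueDecomposition.IsAbsolutelyContinuousPart T S
      (LebesgueDecomposition.absolutelyContinuousPart T S) ∧
    (LebesgueDecomposition.HasUniqueLebesgueDecomposition f g ↔
      ∃ c : ℝ, 0 < c ∧ LebesgueDecomposition.FunctionalLE
        (LebesgueDecomposition.regularPart f g) ((c : ℂ) • f)) ∧
    (LebesgueDecomposition.HasUniqueLebesgueDecomposition f g ↔
      ∃ c : ℝ, 0 < c ∧ LebesgueDecomposition.absolutelyContinuousPart T S ≤ (c : ℂ) • T) := by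
  have hT := hfT.hasDensity hf
  have hS := hgS.hasDensity hg
  obtain ⟨W, hW0, hWS, hWT, hWsing, hWmax, hWdom⟩ :=
    exists_absolutelyContinuousPart hT.nonneg hS.nonneg
  obtain ⟨r, hr⟩ := hS.exists_of_le hW0 hWS
  have hrg : FunctionalLE r g := (hr.functionalLE_iff hS).mpr hWS
  have hrclos : IsClosableWrt f r := hWT.isClosableWrt hT hr
  have hacp : IsAbsolutelyContinuousPart T S W := by
    refine ⟨hW0, hWS, hWT, hWsing, fun R hR hRT hRS => ?_⟩
    obtain ⟨k, hk⟩ := hS.exists_of_le hR hRS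
    exact hWmax R hR hRS ((hRT.isClosableWrt hT hk).isFormClosableWrt hT hk)
  have hreg : IsRegularPart f g r := by
    refine ⟨⟨hr.pos, hrg, (add_sub_cancel r g).symm, hrclos,
      hWsing.mutuallySingularFunctionals hT (hS.sub hr hrg)⟩, fun k hk hkclos hkg => ?_⟩
    obtain ⟨D, hDS, hD⟩ := hS.exists_density_of_functionalLE hk hkg
    exact (hD.functionalLE_iff hr).mpr (hWmax D hD.nonneg hDS (hkclos.isFormClosableWrt hT hD))
  rw [hreg.regularPart_eq, hacp.absolutelyContinuousPart_eq]
  have hdom : (∃ c : ℝ, 0 < c ∧ FunctionalLE r ((c : ℂ) • f)) ↔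
      ∃ c : ℝ, 0 < c ∧ W ≤ (c : ℂ) • T :=
    exists_congr fun c => and_congr_right fun hc => hr.functionalLE_iff (hT.smul hc.le)
  have huniq : HasUniqueLebesgueDecomposition f g ↔ ∃ c : ℝ, 0 < c ∧ W ≤ (c : ℂ) • T := by
    constructor
    · intro hu
      refine hWdom.resolve_right ?_
      rintro ⟨S₀, hWS₀, hS₀W, hne, hsing⟩
      have hS₀ : 0 ≤ S₀ := (operator_smul_nonneg hW0 (by norm_num)).trans hWS₀
      obtain ⟨g₀, hg₀⟩ := hS.exists_of_le hS₀ (hS₀W.trans hWS)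
      have hg₀g : FunctionalLE g₀ g := (hg₀.functionalLE_iff hS).mpr (hS₀W.trans hWS)
      -- `g₀` is comparable to the closable functional `r`, so it is closable
      have hclos₀ : IsClosableWrt f g₀ :=
        hrclos.of_le_of_smul_le hr.pos hg₀.pos ((hg₀.functionalLE_iff hr).mpr hS₀W)
          (show (0 : ℝ) < 2⁻¹ by norm_num)
          (((hr.smul (by norm_num)).functionalLE_iff hg₀).mpr hWS₀)
      have hd : IsLebesgueDecomposition f g g₀ (g - g₀) :=
        ⟨hg₀.pos, hg₀g, (add_sub_cancel g₀ g).symm, hclos₀,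
          hsing.mutuallySingularFunctionals hT (hS.sub hg₀ hg₀g)⟩
      have heq : g₀ = r := congr_arg Prod.fst
        (hu.unique (y₁ := (g₀, g - g₀)) (y₂ := (r, g - r)) hd hreg.decomposition)
      exact hne (hg₀.density_unique (heq ▸ hr))
    · intro h
      obtain ⟨c, hc, hle⟩ := hdom.mpr h
      exact hreg.hasUniqueLebesgueDecomposition hf hc hle
  exact ⟨hreg, hacp, huniq.trans hdom.symm, huniq⟩
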